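/- Conventions. Fix $k\in\{1,2,\dots,\infty\}$; "smooth" means $C^k$. A Lie subgroup $G$ of $\mathrm{GL}(n,\mathbb R)$ is a subgroup endowed with a (second-countable, Hausdorff) topology and a smooth structure for which it is a Lie group and the inclusion is a smooth immersion. It acts on $\mathbb R^n$ by $(g,x)\mapsto gx$ (matrix times vector), with isotropy groups $G_x=\{g\in G: gx=x\}$. The action is *free at* $\overline x$ if $G_{\overline x}=\{e\}$. It is *typical at* $\overline x$ if, for some open $U\ni\overline x$, the set $\{g\in G: U\cap gU\neq\emptyset\}$ has compact closure in $G$, and $G_x$ is conjugate to $G_{\overline x}$ in $G$ for all $x$ near $\overline x$. For $f:\mathbb R^n\to\mathbb R\cup\{\infty\}$, let $\mathrm{dom} f=\{x: f(x)<\infty\}$. At $x\in\mathrm{dom} f$ let $\widehat\partial f(x)$ be the set of $v$ with $f(y)\ge f(x)+\langle v,y-x\rangle+o(|y-x|)$ for $y$ near $x$; let $\partial f(x)$ be the set of limits of sequences $v_i\in\widehat\partial f(x_i)$ with $x_i\to x$ and $f(x_i)\to f(x)$; let $\partial^\infty f(x)$ be the set of limits of $\tau_iv_i$ with $\tau_i\searrow0$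 and $v_i\in\widehat\partial f(x_i)$, $x_i\to x$, $f(x_i)\to f(x)$; and let $\overline\partial f(x)=\overline{\mathrm{co}}\,[\partial f(x)+\partial^\infty f(x)]$ be the Clarke subdifferential. All these sets are empty where $f(x)=\infty$; $\mathrm{dom}\,\partial f=\{x:\partial f(x)\ne\emptyset\}$. The function $f$ is *Lipschitz continuous near* $\overline x$ if, for some $L>0$, $|f(x)-f(y)|\le L|x-y|$ for all $x,y\in\mathrm{dom} f$ near $\overline x$. It is *regular at* $\overline x$ if $f(\overline x)$ is finite and, at the point $(\overline x,f(\overline x))$, the epigraph of $f$ is locally closed and its regular normal cone equals its limiting normal cone. Here the regular normal cone $\widehat N_S(z)$ of a set $S$ at $z\in S$ is the set of $v$ with $\langle v,y-z\rangle\le o(|y-z|)$ for $y\in S$ near $z$, and the limiting normal cone at $z$ is the set of limits of sequences $v_i\in\widehat N_S(z_i)$ with $z_i\in S$, $z_i\to z$. **Statement.** Let $f:\mathbb R^n\to\mathbb R\cup\{\infty\}$ be invariant under the natural action of a Lie subgroup $G$ of $\mathrm{GL}(n,\mathbb R)$, i.e. $f(gx)=f(x)$ for all $g\in G$, $x\in\mathbb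 R^n$. Let $\mathfrak g=T_{I_n}G\subset\mathbb R^{n\times n}$ be its Lie algebra, $\mathrm s(\mathfrak g)$ the subspace of symmetric matrices in $\mathfrak g$, and $C(x)=P_{\mathrm s(\mathfrak g)}(xx^T)$, where $P_{\mathrm s(\mathfrak g)}$ is the orthogonal projection onto $\mathrm s(\mathfrak g)$ for the Frobenius inner product. Fix $\overline x\in\mathrm{dom} f$ and suppose that at least one of the following holds: 1. the action is free at $\overline x$ or typical at $\overline x$; 2. $\overline x\in\mathrm{int}\,\mathrm{dom} f$ and $f$ is Lipschitz continuous near $\overline x$, or $f$ is regular at $\overline x$. Then there is an open neighborhood $U$ of $\overline x$ such that for all $x\in U\cap\mathrm{dom}\,\partial f$ and all $v\in\overline\partial f(x)$, $$C(x+\alpha v)=C(x)+\alpha^2C(v)\ \text{ for all }\alpha\in\mathbb R,\qquad\text{and}\qquad dC(x)(v)=0,$$ $C$ being differentiable at $x$. In particular, $C$ is conserved in $U$ along the subgradient flow: let $J\subseteq\mathbb R$ be an interval and let $x(\cdot)$ be absolutely continuous on the compact subintervals of $J$ with $x'(t)\in-\overline\partial f(x(t))$ for almost every $t\in J$. Then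 $(C\circ x)'(t)=0$ for almost every $t\in J$ with $x(t)\in U$, and $C\circ x$ is constant on every interval $I\subseteq J$ such that $x(I)\subseteq U$. -/

import Mathlib

open Set Filter Topology MeasureTheory
open scoped Manifold ContDiff InnerProductSpace Pointwise

/-! ### Variational analysis in a Euclidean space -/

section VariationalAnalysis

variable {E : Type*} [NormedAddCommGroup E] [InnerProductSpace ℝ E]

/-- The effective domain of an extended real-valued function. -/
def effDom (f : E → EReal) : Set E := {x | f x < ⊤}

/-- The epigraph of `f`, as a subset of the Euclidean space `E × ℝ`. -/
def epigraph (f : E → EReal) : Set (WithLp 2 (E × ℝ)) := {p | f p.fst ≤ (p.snd : EReal)}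

/-- The regular normal cone of `S` at a point `x` of `S`: the vectors `v` with
`⟪v, y - x⟫ ≤ o(‖y - x‖)` as `y → x` in `S`. -/
def regularNormalCone (S : Set E) (x : E) : Set E :=
  {v | ∀ ε : ℝ, 0 < ε → ∀ᶠ y in 𝓝[S] x, ⟪v, y - x⟫_ℝ ≤ ε * ‖y - x‖}

/-- The (limiting) normal cone of `S` at `x`. -/
def normalCone (S : Set E) (x : E) : Set E :=
  {v | ∃ (y : ℕ → E) (w : ℕ → E), (∀ i, y i ∈ S) ∧ (∀ i, w i ∈ regularNormalCone S (y i)) ∧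
    Tendsto y atTop (𝓝 x) ∧ Tendsto w atTop (𝓝 v)}

/-- `S` is regular at `x`: `x` belongs to `S`, `S` is locally closed at `x`, and the regular normal
cone and the normal cone of `S` at `x` agree. -/
def IsRegularSetAt (S : Set E) (x : E) : Prop :=
  x ∈ S ∧ (∃ V ∈ 𝓝 x, IsClosed V ∧ IsClosed (S ∩ V)) ∧ regularNormalCone S x = normalCone S x

/-- `f` is regular at `x`: `f x` is finite and the epigraph of `f` is regular at `(x, f x)`. -/
def IsRegularFunAt (f : E → EReal) (x : E) : Prop :=
  f x ≠ ⊥ ∧ f x ≠ ⊤ ∧ IsRegularSetAt (epigraph f) (WithLp.toLp 2 (x, (f x).toReal))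

/-- `f` is Lipschitz continuous near `x`: for some `L > 0`, the inequality
`|f y - f z| ≤ L ‖y - z‖` holds for all `y, z` in the domain of `f` near `x`. -/
def IsLipschitzNear (f : E → EReal) (x : E) : Prop :=
  ∃ L : ℝ, 0 < L ∧ ∃ U ∈ 𝓝 x, ∀ y ∈ U ∩ effDom f, ∀ z ∈ U ∩ effDom f,
    |(f y).toReal - (f z).toReal| ≤ L * ‖y - z‖

/-- The regular subdifferential of `f` at `x`: if `f x` is finite, the vectors `v` with
`f y ≥ f x + ⟪v, y - x⟫ + o(‖y - x‖)` near `x`; otherwise empty. -/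
def regularSubdiff (f : E → EReal) (x : E) : Set E :=
  {v | f x ≠ ⊥ ∧ f x ≠ ⊤ ∧ ∀ ε : ℝ, 0 < ε → ∀ᶠ y in 𝓝 x,
    (((f x).toReal + ⟪v, y - x⟫_ℝ - ε * ‖y - x‖ : ℝ) : EReal) ≤ f y}

/-- The (limiting) subdifferential `∂f(x)`. -/
def limitingSubdiff (f : E → EReal) (x : E) : Set E :=
  {v | f x ≠ ⊥ ∧ f x ≠ ⊤ ∧ ∃ (y : ℕ → E) (w : ℕ → E), (∀ i, w i ∈ regularSubdiff f (y i)) ∧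
    Tendsto y atTop (𝓝 x) ∧ Tendsto (fun i => f (y i)) atTop (𝓝 (f x)) ∧
    Tendsto w atTop (𝓝 v)}

/-- The horizon subdifferential `∂^∞f(x)`. -/
def horizonSubdiff (f : E → EReal) (x : E) : Set E :=
  {v | f x ≠ ⊥ ∧ f x ≠ ⊤ ∧ ∃ (y : ℕ → E) (w : ℕ → E) (τ : ℕ → ℝ),
    (∀ i, w i ∈ regularSubdiff f (y i)) ∧ (∀ i, 0 < τ i) ∧ Tendsto τ atTop (𝓝 0) ∧
    Tendsto y atTop (𝓝 x) ∧ Tendsto (fun i => f (y i)) atTop (𝓝 (f x)) ∧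
    Tendsto (fun i => τ i • w i) atTop (𝓝 v)}

/-- The Clarke subdifferential: the closed convex hull of the Minkowski sum `∂f(x) + ∂^∞f(x)`. -/
def clarkeSubdiff (f : E → EReal) (x : E) : Set E :=
  closure (convexHull ℝ (limitingSubdiff f x + horizonSubdiff f x))

/-- `x` is a solution on the interval `J` of the differential inclusion
`x'(t) ∈ - clarkeSubdiff f (x t)` for almost every `t ∈ J`: it is absolutely continuous on every
compact subinterval of `J` and satisfies the inclusion almost everywhere in `J`. -/
def IsSubgradientTrajectory (f : E → EReal) (J : Set ℝ) (x : ℝ → E) : Prop :=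
  (∀ a ∈ J, ∀ b ∈ J, AbsolutelyContinuousOnInterval x a b) ∧
    ∀ᵐ t ∂volume.restrict J, ∃ v ∈ clarkeSubdiff f (x t), HasDerivAt x (-v) t

end VariationalAnalysis

/-! ### Lie subgroups of `GL(n, ℝ)` and their natural action -/

/-- The space of real `n × n` matrices, identified by their entries, with the Frobenius inner product
`⟪A, B⟫ = ∑ i j, A i j * B i j`, that is, the Euclidean space of families indexed by pairs. -/
abbrev MatSpace (n : ℕ) : Type := EuclideanSpace ℝ (Fin n × Fin n)

/-- A matrix as an element of `MatSpace n`. -/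
def toMatSpace {n : ℕ} (A : Matrix (Fin n) (Fin n) ℝ) : MatSpace n :=
  WithLp.toLp 2 fun p => A p.1 p.2

section NaturalAction

variable {n : ℕ} {G : Type*} [Group G]

/-- The inclusion of `G` into the space of matrices. -/
def inclMat (ι : G →* GL (Fin n) ℝ) (g : G) : MatSpace n :=
  toMatSpace (ι g : Matrix (Fin n) (Fin n) ℝ)

/-- `G`, a Lie group of class `C^k` and dimension `d`, is a Lie subgroup of `GL(n, ℝ)` through the
inclusion `ι`: `ι` is an injective group homomorphism and an immersion of class `C^k`. Here
`GL(n, ℝ)` carries its structure of open submanifold of the space of `n × n` matrices, so that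
smoothness and differentials are those of the matrix-valued map `inclMat ι`. -/
structure IsLieSubgroup (d : ℕ) (k : ℕ∞) [TopologicalSpace G]
    [ChartedSpace (EuclideanSpace ℝ (Fin d)) G] (ι : G →* GL (Fin n) ℝ) : Prop where
  injective : Function.Injective ι
  contMDiff : ContMDiff 𝓘(ℝ, EuclideanSpace ℝ (Fin d)) 𝓘(ℝ, MatSpace n) k (inclMat ι)
  mfderiv_injective : ∀ g : G, Function.Injective
    (mfderiv 𝓘(ℝ, EuclideanSpace ℝ (Fin d)) 𝓘(ℝ, MatSpace n) (inclMat ι) g)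

/-- The Lie algebra of the Lie subgroup `G`: its tangent space at the identity, as a space of
matrices (the image of the differential of the inclusion at the identity). -/
noncomputable def lieAlg (d : ℕ) [TopologicalSpace G]
    [ChartedSpace (EuclideanSpace ℝ (Fin d)) G] (ι : G →* GL (Fin n) ℝ) :
    Submodule ℝ (MatSpace n) :=
  (mfderiv 𝓘(ℝ, EuclideanSpace ℝ (Fin d)) 𝓘(ℝ, MatSpace n) (inclMat ι) (1 : G)).range

/-- The subspace of symmetric elements of a space of matrices. -/
def symmPart (L : Submodule ℝ (MatSpace n)) : Submodule ℝ (MatSpace n) where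
  carrier := {A | A ∈ L ∧ ∀ i j, A (i, j) = A (j, i)}
  add_mem' hA hB := ⟨L.add_mem hA.1 hB.1, fun i j => by simp [hA.2 i j, hB.2 i j]⟩
  zero_mem' := ⟨L.zero_mem, fun _ _ => rfl⟩
  smul_mem' c _ hA := ⟨L.smul_mem c hA.1, fun i j => by simp [hA.2 i j]⟩

/-- The map `C(x) = P_S(x xᵀ)`, where `S` is the space of symmetric elements of the Lie algebra of
`G` and `P_S` is the projection onto `S` for the Frobenius inner product. -/
noncomputable def conservedMap (d : ℕ) [TopologicalSpace G]
    [ChartedSpace (EuclideanSpace ℝ (Fin d)) G] (ι : G →* GL (Fin n) ℝ)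
    (x : EuclideanSpace ℝ (Fin n)) : MatSpace n :=
  (symmPart (lieAlg d ι)).starProjection (toMatSpace (Matrix.vecMulVec x.ofLp x.ofLp))

/-- The natural action `g x`: the matrix of `g` times the vector `x`. -/
def natAct (ι : G →* GL (Fin n) ℝ) (g : G) (x : EuclideanSpace ℝ (Fin n)) :
    EuclideanSpace ℝ (Fin n) :=
  WithLp.toLp 2 ((ι g : Matrix (Fin n) (Fin n) ℝ).mulVec x.ofLp)

theorem natAct_one (ι : G →* GL (Fin n) ℝ) (x : EuclideanSpace ℝ (Fin n)) :
    natAct ι 1 x = x := by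
  simp [natAct]

theorem natAct_mul (ι : G →* GL (Fin n) ℝ) (g h : G) (x : EuclideanSpace ℝ (Fin n)) :
    natAct ι (g * h) x = natAct ι g (natAct ι h x) := by
  simp [natAct, Matrix.mulVec_mulVec]

/-- The isotropy group of `x`. -/
def isotropyGroup (ι : G →* GL (Fin n) ℝ) (x : EuclideanSpace ℝ (Fin n)) : Subgroup G where
  carrier := {g | natAct ι g x = x}
  mul_mem' {g h} hg hh := by
    change natAct ι (g * h) x = x
    rw [natAct_mul, show natAct ι h x = x from hh]
    exact hg
  one_mem' := natAct_one ι x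
  inv_mem' {g} hg := by
    change natAct ι g⁻¹ x = x
    conv_lhs => rw [← show natAct ι g x = x from hg]
    rw [← natAct_mul, inv_mul_cancel, natAct_one]

/-- The action is free at `x`: the isotropy group of `x` is trivial. -/
def IsFreeAt (ι : G →* GL (Fin n) ℝ) (x : EuclideanSpace ℝ (Fin n)) : Prop :=
  isotropyGroup ι x = ⊥

/-- The action is proper near `x`: for some open `U` containing `x`, the set of `g` such that `U`
meets `g U` has compact closure in `G`. -/
def IsProperNear [TopologicalSpace G] (ι : G →* GL (Fin n) ℝ)
    (x : EuclideanSpace ℝ (Fin n)) : Prop :=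
  ∃ U : Set (EuclideanSpace ℝ (Fin n)), IsOpen U ∧ x ∈ U ∧
    IsCompact (closure {g : G | (U ∩ natAct ι g '' U).Nonempty})

/-- Two points have the same orbit type: their isotropy groups are conjugate. -/
def SameOrbitType (ι : G →* GL (Fin n) ℝ) (x y : EuclideanSpace ℝ (Fin n)) : Prop :=
  ∃ g : G, isotropyGroup ι x = (isotropyGroup ι y).map (MulAut.conj g).toMonoidHom

/-- The action is typical at `x`: it is proper near `x` and the orbit type is constant near `x`. -/
def IsTypicalAt [TopologicalSpace G] (ι : G →* GL (Fin n) ℝ)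
    (x : EuclideanSpace ℝ (Fin n)) : Prop :=
  IsProperNear ι x ∧ ∀ᶠ y in 𝓝 x, SameOrbitType ι y x

end NaturalAction

/-!
For `A` in the Lie algebra, let `g t` be a curve in `G` issuing from the identity with velocity `A`.
Since `f` is constant along `t ↦ g t • x`, each regular subgradient of `f` at `x` is orthogonal to
the velocity `A x`. This relation is linear in the subgradient and continuous in `x`, so it passes
to limits, sums and closed convex hulls, hence to all Clarke subgradients `v` of `f` at `x`.
By `⟪A, v xᵀ⟫ = ⟪v, A x⟫` it says that `v xᵀ` is orthogonal to the Lie algebra, so that the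
bilinear form `P (v xᵀ)` polarizing `C` vanishes; up to a scalar factor, this is both the cross term
of `C (x + α v)` and the derivative of `C` at `x` along `v`.
-/

section Subgradients

variable {E : Type*} [NormedAddCommGroup E] [InnerProductSpace ℝ E] {f : E → EReal} {x v w : E}

theorem eventually_inner_le_of_mem_regularSubdiff (hv : v ∈ regularSubdiff f x) {ε : ℝ}
    (hε : 0 < ε) : ∀ᶠ y in 𝓝 x, f y ≤ f x → ⟪v, y - x⟫_ℝ ≤ ε * ‖y - x‖ := by
  obtain ⟨hbot, htop, hv⟩ := hv
  filter_upwards [hv ε hε] with y hy hyx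
  have hle := hy.trans hyx
  rw [← EReal.coe_toReal htop hbot, EReal.coe_le_coe_iff, EReal.toReal_coe] at hle
  linarith

theorem inner_nonpos_of_mem_regularSubdiff {γ : ℝ → E} {t₀ : ℝ}
    (hv : v ∈ regularSubdiff f (γ t₀)) (hγ : HasDerivWithinAt γ w (Ioi t₀) t₀)
    (hf : ∀ᶠ t in 𝓝[>] t₀, f (γ t) ≤ f (γ t₀)) : ⟪v, w⟫_ℝ ≤ 0 := by
  have hslope := (hasDerivWithinAt_iff_tendsto_slope' self_notMem_Ioi).1 hγ
  have hbound : ∀ ε : ℝ, 0 < ε → ⟪v, w⟫_ℝ ≤ ε * ‖w‖ := by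
    intro ε hε
    refine le_of_tendsto_of_tendsto (tendsto_const_nhds.inner hslope)
      (hslope.norm.const_mul ε) ?_
    filter_upwards [hγ.continuousWithinAt.eventually
      (eventually_inner_le_of_mem_regularSubdiff hv hε), hf, self_mem_nhdsWithin] with t ht hft htt₀
    have hpos : 0 < (t - t₀)⁻¹ := inv_pos.2 (sub_pos.2 htt₀)
    rw [slope_def_module, inner_smul_right, norm_smul, Real.norm_of_nonneg hpos.le, mul_left_comm]
    exact mul_le_mul_of_nonneg_left (ht hft) hpos.le
  have hlim : Tendsto (fun ε : ℝ => ε * ‖w‖) (𝓝[>] 0) (𝓝 0) :=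
    ((continuous_mul_const ‖w‖).tendsto' 0 0 (zero_mul _)).mono_left nhdsWithin_le_nhds
  exact ge_of_tendsto hlim (eventually_mem_nhdsWithin.mono hbound)

theorem inner_eq_zero_of_mem_regularSubdiff_of_isLocalMax {γ : ℝ → E} {t₀ : ℝ}
    (hv : v ∈ regularSubdiff f (γ t₀)) (hγ : HasDerivAt γ w t₀)
    (hmax : IsLocalMax (fun t => f (γ t)) t₀) : ⟪v, w⟫_ℝ = 0 := by
  let σ : ℝ → ℝ := fun t => t₀ + t₀ - t
  have hσ : σ t₀ = t₀ := add_sub_cancel_right t₀ t₀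
  have hσ_tendsto : Tendsto σ (𝓝[>] t₀) (𝓝 t₀) :=
    (Continuous.tendsto' (by fun_prop) t₀ t₀ hσ).mono_left nhdsWithin_le_nhds
  have hγσ : HasDerivAt (γ ∘ σ) (-w) t₀ :=
    HasDerivAt.comp_const_sub _ _ (by rwa [add_sub_cancel_right])
  have hforward : ⟪v, w⟫_ℝ ≤ 0 :=
    inner_nonpos_of_mem_regularSubdiff hv hγ.hasDerivWithinAt (hmax.filter_mono nhdsWithin_le_nhds)
  have hbackward : ⟪v, -w⟫_ℝ ≤ 0 :=
    inner_nonpos_of_mem_regularSubdiff (γ := γ ∘ σ) (by rwa [Function.comp_apply, hσ])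
      hγσ.hasDerivWithinAt
      (by simpa only [Function.comp_apply, hσ] using hσ_tendsto.eventually hmax)
  rw [inner_neg_right] at hbackward
  linarith

variable {X : E → E}

theorem inner_eq_zero_of_mem_limitingSubdiff (hX : ContinuousAt X x)
    (h : ∀ᶠ y in 𝓝 x, ∀ w ∈ regularSubdiff f y, ⟪w, X y⟫_ℝ = 0)
    (hv : v ∈ limitingSubdiff f x) : ⟪v, X x⟫_ℝ = 0 := by
  obtain ⟨-, -, y, w, hw, hy, -, hwv⟩ := hv
  refine tendsto_nhds_unique_of_eventuallyEq (hwv.inner (hX.tendsto.comp hy))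
    tendsto_const_nhds ?_
  filter_upwards [hy.eventually h] with i hi using hi (w i) (hw i)

theorem inner_eq_zero_of_mem_horizonSubdiff (hX : ContinuousAt X x)
    (h : ∀ᶠ y in 𝓝 x, ∀ w ∈ regularSubdiff f y, ⟪w, X y⟫_ℝ = 0)
    (hv : v ∈ horizonSubdiff f x) : ⟪v, X x⟫_ℝ = 0 := by
  obtain ⟨-, -, y, w, τ, hw, -, -, hy, -, hwv⟩ := hv
  refine tendsto_nhds_unique_of_eventuallyEq (hwv.inner (hX.tendsto.comp hy))
    tendsto_const_nhds ?_
  filter_upwards [hy.eventually h] with i hi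
  rw [Function.comp_apply, real_inner_smul_left, hi (w i) (hw i), mul_zero]

theorem inner_eq_zero_of_mem_clarkeSubdiff (hX : ContinuousAt X x)
    (h : ∀ᶠ y in 𝓝 x, ∀ w ∈ regularSubdiff f y, ⟪w, X y⟫_ℝ = 0)
    (hv : v ∈ clarkeSubdiff f x) : ⟪v, X x⟫_ℝ = 0 := by
  let K : Submodule ℝ E := (ℝ ∙ X x)ᗮ
  have mem_K {w : E} : w ∈ K ↔ ⟪w, X x⟫_ℝ = 0 := Submodule.mem_orthogonal_singleton_iff_inner_left
  have hsum : limitingSubdiff f x + horizonSubdiff f x ⊆ K := by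
    rintro _ ⟨a, ha, b, hb, rfl⟩
    exact K.add_mem (mem_K.2 (inner_eq_zero_of_mem_limitingSubdiff hX h ha))
      (mem_K.2 (inner_eq_zero_of_mem_horizonSubdiff hX h hb))
  have hK : IsClosed (K : Set E) := Submodule.isClosed_orthogonal _
  have hsub : clarkeSubdiff f x ⊆ K := closure_minimal (convexHull_min hsum K.convex) hK
  exact mem_K.1 (hsub hv)

end Subgradients

section Curves

theorem absolutelyContinuousOnInterval_comp_of_lipschitzOnWith {X Y : Type*}
    [PseudoMetricSpace X] [PseudoMetricSpace Y] {φ : X → Y} {x : ℝ → X} {a b : ℝ} {K : NNReal}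
    (hφ : LipschitzOnWith K φ (x '' uIcc a b)) (hx : AbsolutelyContinuousOnInterval x a b) :
    AbsolutelyContinuousOnInterval (fun t => φ (x t)) a b := by
  refine squeeze_zero' (Eventually.of_forall fun _ => Finset.sum_nonneg fun _ _ => dist_nonneg) ?_
    (by simpa only [mul_zero] using Tendsto.const_mul (K : ℝ) hx)
  refine eventually_inf_principal.2 (Eventually.of_forall fun I hI => ?_)
  rw [Finset.mul_sum]
  exact Finset.sum_le_sum fun i hi =>
    hφ.dist_le_mul _ (mem_image_of_mem x (hI.1 i hi).1) _ (mem_image_of_mem x (hI.1 i hi).2)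

theorem absolutelyContinuousOnInterval_comp_of_locallyLipschitz {E Y : Type*}
    [SeminormedAddCommGroup E] [PseudoMetricSpace Y] {φ : E → Y} (hφ : LocallyLipschitz φ)
    {x : ℝ → E} {a b : ℝ} (hx : AbsolutelyContinuousOnInterval x a b) :
    AbsolutelyContinuousOnInterval (fun t => φ (x t)) a b := by
  obtain ⟨K, hK⟩ := hφ.locallyLipschitzOn.exists_lipschitzOnWith_of_compact
    (isCompact_uIcc.image_of_continuousOn hx.continuousOn)
  exact absolutelyContinuousOnInterval_comp_of_lipschitzOnWith hK hx

variable {E F : Type*} [NormedAddCommGroup E] [InnerProductSpace ℝ E]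
  [NormedAddCommGroup F] [NormedSpace ℝ F] {f : E → EReal} {φ : E → F} {J : Set ℝ} {x : ℝ → E}

theorem IsSubgradientTrajectory.ae_hasDerivAt_comp_zero (hx : IsSubgradientTrajectory f J x)
    (hφ : Differentiable ℝ φ) (hzero : ∀ y, ∀ v ∈ clarkeSubdiff f y, fderiv ℝ φ y v = 0) :
    ∀ᵐ t ∂volume.restrict J, HasDerivAt (fun s => φ (x s)) 0 t := by
  filter_upwards [hx.2] with t ⟨v, hv, hxt⟩
  simpa only [map_neg, hzero (x t) v hv, neg_zero, Function.comp_def] using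
    (hφ (x t)).hasFDerivAt.comp_hasDerivAt t hxt

theorem IsSubgradientTrajectory.comp_eq (hx : IsSubgradientTrajectory f J x)
    (hJ : J.OrdConnected) (hφ : ContDiff ℝ 1 φ)
    (hzero : ∀ y, ∀ v ∈ clarkeSubdiff f y, fderiv ℝ φ y v = 0) {s t : ℝ} (hs : s ∈ J)
    (ht : t ∈ J) : φ (x s) = φ (x t) := by
  have hderiv : ∀ᵐ r, r ∈ J → HasDerivAt (fun r => φ (x r)) 0 r :=
    (ae_restrict_iff' hJ.measurableSet).1
      (hx.ae_hasDerivAt_comp_zero (hφ.differentiable one_ne_zero) hzero)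
  obtain ⟨c, hc⟩ := (absolutelyContinuousOnInterval_comp_of_locallyLipschitz hφ.locallyLipschitz
    (hx.1 s hs t ht)).const_of_ae_hasDerivAt_zero
      (hderiv.mono fun r hr hrst => hr (hJ.uIcc_subset hs ht hrst))
  rw [hc s left_mem_uIcc, hc t right_mem_uIcc]

theorem exists_curve_hasDerivAt_of_mem_range_mfderiv {E H M V : Type*} [NormedAddCommGroup E]
    [NormedSpace ℝ E] [TopologicalSpace H] {I : ModelWithCorners ℝ E H} [I.Boundaryless]
    [TopologicalSpace M] [ChartedSpace H M] [NormedAddCommGroup V] [NormedSpace ℝ V] {F : M → V}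
    {p : M} (hF : MDifferentiableAt I 𝓘(ℝ, V) F p) {u : V}
    (hu : u ∈ (mfderiv I 𝓘(ℝ, V) F p).range) :
    ∃ γ : ℝ → M, γ 0 = p ∧ HasDerivAt (fun t => F (γ t)) u 0 := by
  obtain ⟨w, rfl⟩ := hu
  change E at w
  let e := extChartAt I p
  have hline : HasDerivAt (fun t : ℝ => e p + t • w) w 0 := by
    simpa only [id_eq, one_smul] using ((hasDerivAt_id (0 : ℝ)).smul_const w).const_add (e p)
  let D : E →L[ℝ] V := mfderiv I 𝓘(ℝ, V) F p
  have hchart : HasFDerivAt (F ∘ e.symm) D (e p) := by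
    have hwithin : HasFDerivWithinAt (F ∘ e.symm) D (range I) (e p) := hF.hasMFDerivAt.2
    rwa [I.range_eq_univ, hasFDerivWithinAt_univ] at hwithin
  refine ⟨fun t => e.symm (e p + t • w), ?_,
    hchart.comp_hasDerivAt_of_eq (0 : ℝ) hline (by rw [zero_smul, add_zero])⟩
  simp only [zero_smul, add_zero, e, extChartAt_to_inv]

end Curves

section ConservedMap

variable {n : ℕ}

/-- The product `A x` of a matrix and a vector, as a bilinear map on `MatSpace n`. -/
noncomputable def matAct (n : ℕ) :
    MatSpace n →ₗ[ℝ] EuclideanSpace ℝ (Fin n) →ₗ[ℝ] EuclideanSpace ℝ (Fin n) :=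
  LinearMap.mk₂ ℝ (fun A x => WithLp.toLp 2 fun i => ∑ j, A (i, j) * x j)
    (fun A B x => by ext i; simp [add_mul, Finset.sum_add_distrib])
    (fun c A x => by ext i; simp [mul_assoc, Finset.mul_sum])
    (fun A x y => by ext i; simp [mul_add, Finset.sum_add_distrib])
    (fun c A x => by ext i; simp [mul_left_comm, Finset.mul_sum])

@[simp]
theorem matAct_apply (A : MatSpace n) (x : EuclideanSpace ℝ (Fin n)) (i : Fin n) :
    matAct n A x i = ∑ j, A (i, j) * x j := rfl

theorem natAct_eq_matAct {G : Type*} [Group G] (ι : G →* GL (Fin n) ℝ) (g : G)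
    (x : EuclideanSpace ℝ (Fin n)) :
    natAct ι g x = matAct n (inclMat ι g) x := rfl

/-- The matrix `x yᵀ`, as a bilinear map into `MatSpace n`. -/
noncomputable def outerProd (n : ℕ) :
    EuclideanSpace ℝ (Fin n) →ₗ[ℝ] EuclideanSpace ℝ (Fin n) →ₗ[ℝ] MatSpace n :=
  LinearMap.mk₂ ℝ (fun x y => toMatSpace (Matrix.vecMulVec x.ofLp y.ofLp))
    (fun x x' y => by ext p; simp [toMatSpace, Matrix.vecMulVec_apply, add_mul])
    (fun c x y => by ext p; simp [toMatSpace, Matrix.vecMulVec_apply, mul_assoc])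
    (fun x y y' => by ext p; simp [toMatSpace, Matrix.vecMulVec_apply, mul_add])
    (fun c x y => by ext p; simp [toMatSpace, Matrix.vecMulVec_apply, mul_left_comm])

@[simp]
theorem outerProd_apply (x y : EuclideanSpace ℝ (Fin n)) (i j : Fin n) :
    outerProd n x y (i, j) = x i * y j := rfl

theorem inner_outerProd (A : MatSpace n) (x y : EuclideanSpace ℝ (Fin n)) :
    ⟪A, outerProd n x y⟫_ℝ = ⟪x, matAct n A y⟫_ℝ := by
  simp only [PiLp.inner_apply, Fintype.sum_prod_type, outerProd_apply, matAct_apply,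
    RCLike.inner_apply, conj_trivial, Finset.sum_mul]
  exact Finset.sum_congr rfl fun i _ => Finset.sum_congr rfl fun j _ => by ring

theorem inner_outerProd_comm {A : MatSpace n} (hA : ∀ i j, A (i, j) = A (j, i))
    (x y : EuclideanSpace ℝ (Fin n)) : ⟪A, outerProd n x y⟫_ℝ = ⟪A, outerProd n y x⟫_ℝ := by
  simp only [PiLp.inner_apply, Fintype.sum_prod_type, outerProd_apply, RCLike.inner_apply,
    conj_trivial]
  rw [Finset.sum_comm]
  exact Finset.sum_congr rfl fun i _ => Finset.sum_congr rfl fun j _ => by rw [hA, mul_comm (y i)]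

/-- The bilinear map `(x, y) ↦ P_S(x yᵀ)`, where `P_S` is the orthogonal projection onto the space
of matrices `S`; it polarizes the conserved map when `S` consists of symmetric matrices. -/
noncomputable def projOuterProd (S : Submodule ℝ (MatSpace n)) :
    EuclideanSpace ℝ (Fin n) →L[ℝ] EuclideanSpace ℝ (Fin n) →L[ℝ] MatSpace n :=
  ((outerProd n).compr₂ (S.starProjection : MatSpace n →ₗ[ℝ] MatSpace n)).toContinuousBilinearMap

theorem projOuterProd_apply (S : Submodule ℝ (MatSpace n)) (x y : EuclideanSpace ℝ (Fin n)) :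
    projOuterProd S x y = S.starProjection (outerProd n x y) := rfl

theorem projOuterProd_eq_zero_iff {S : Submodule ℝ (MatSpace n)} {x y : EuclideanSpace ℝ (Fin n)} :
    projOuterProd S x y = 0 ↔ ∀ A ∈ S, ⟪x, matAct n A y⟫_ℝ = 0 := by
  simp only [projOuterProd_apply, Submodule.starProjection_apply_eq_zero_iff,
    Submodule.mem_orthogonal, inner_outerProd]

theorem projOuterProd_comm {S : Submodule ℝ (MatSpace n)}
    (hS : ∀ A ∈ S, ∀ i j, A (i, j) = A (j, i)) (x y : EuclideanSpace ℝ (Fin n)) :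
    projOuterProd S x y = projOuterProd S y x := by
  rw [projOuterProd_apply, projOuterProd_apply, ← sub_eq_zero, ← map_sub,
    Submodule.starProjection_apply_eq_zero_iff, Submodule.mem_orthogonal]
  intro A hA
  rw [inner_sub_right, inner_outerProd_comm (hS A hA), sub_self]

variable {d : ℕ} {G : Type*} [Group G] [TopologicalSpace G]
  [ChartedSpace (EuclideanSpace ℝ (Fin d)) G] (ι : G →* GL (Fin n) ℝ)

theorem conservedMap_eq_projOuterProd (x : EuclideanSpace ℝ (Fin n)) :
    conservedMap d ι x = projOuterProd (symmPart (lieAlg d ι)) x x := rfl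

theorem conservedMap_add_smul (x v : EuclideanSpace ℝ (Fin n)) (α : ℝ) :
    conservedMap d ι (x + α • v) = conservedMap d ι x +
      (2 * α) • projOuterProd (symmPart (lieAlg d ι)) v x + α ^ 2 • conservedMap d ι v := by
  have hcomm := projOuterProd_comm (S := symmPart (lieAlg d ι)) (fun _ hA => And.right hA) x v
  simp only [conservedMap_eq_projOuterProd, map_add, map_smul, add_apply, smul_apply, hcomm]
  module

theorem fderiv_conservedMap_apply (x v : EuclideanSpace ℝ (Fin n)) :
    fderiv ℝ (conservedMap d ι) x v = (2 : ℝ) • projOuterProd (symmPart (lieAlg d ι)) v x := by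
  have hcomm := projOuterProd_comm (S := symmPart (lieAlg d ι)) (fun _ hA => And.right hA) x v
  have hderiv : HasFDerivAt (conservedMap d ι) _ x :=
    (projOuterProd (symmPart (lieAlg d ι))).hasFDerivAt.clm_apply (hasFDerivAt_id x)
  simp [hderiv.fderiv, hcomm, two_smul]

theorem contDiff_conservedMap : ContDiff ℝ 1 (conservedMap d ι) :=
  (projOuterProd (symmPart (lieAlg d ι))).contDiff.clm_apply contDiff_id

variable {ι} {f : EuclideanSpace ℝ (Fin n) → EReal}

theorem inner_matAct_eq_zero_of_mem_regularSubdiff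
    (hι : MDifferentiableAt 𝓘(ℝ, EuclideanSpace ℝ (Fin d)) 𝓘(ℝ, MatSpace n) (inclMat ι) 1)
    (hf : ∀ (g : G) (x : EuclideanSpace ℝ (Fin n)), f (natAct ι g x) = f x) {A : MatSpace n}
    (hA : A ∈ lieAlg d ι) {x v : EuclideanSpace ℝ (Fin n)} (hv : v ∈ regularSubdiff f x) :
    ⟪v, matAct n A x⟫_ℝ = 0 := by
  obtain ⟨g, hg, hgA⟩ := exists_curve_hasDerivAt_of_mem_range_mfderiv hι hA
  have horbit : HasDerivAt (fun t => natAct ι (g t) x) (matAct n A x) 0 := by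
    simp only [natAct_eq_matAct]
    exact ((matAct n).flip x).toContinuousLinearMap.hasFDerivAt.comp_hasDerivAt (0 : ℝ) hgA
  refine inner_eq_zero_of_mem_regularSubdiff_of_isLocalMax (f := f) ?_ horbit
    (Eventually.of_forall fun t => by simp only [hf, le_refl])
  rwa [hg, natAct_one]

theorem projOuterProd_eq_zero_of_mem_clarkeSubdiff
    (hι : MDifferentiableAt 𝓘(ℝ, EuclideanSpace ℝ (Fin d)) 𝓘(ℝ, MatSpace n) (inclMat ι) 1)
    (hf : ∀ (g : G) (x : EuclideanSpace ℝ (Fin n)), f (natAct ι g x) = f x)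
    {x v : EuclideanSpace ℝ (Fin n)} (hv : v ∈ clarkeSubdiff f x) :
    projOuterProd (lieAlg d ι) v x = 0 :=
  projOuterProd_eq_zero_iff.2 fun A hA =>
    inner_eq_zero_of_mem_clarkeSubdiff (matAct n A).continuous_of_finiteDimensional.continuousAt
      (Eventually.of_forall fun _ _ => inner_matAct_eq_zero_of_mem_regularSubdiff hι hf hA) hv

end ConservedMap

theorem mainTheorem4_general {n d : ℕ} {G : Type*} [Group G] [TopologicalSpace G]
    [ChartedSpace (EuclideanSpace ℝ (Fin d)) G] (ι : G →* GL (Fin n) ℝ)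
    (hι : MDifferentiableAt 𝓘(ℝ, EuclideanSpace ℝ (Fin d)) 𝓘(ℝ, MatSpace n) (inclMat ι) 1)
    (f : EuclideanSpace ℝ (Fin n) → EReal)
    (hf_inv : ∀ (g : G) (x : EuclideanSpace ℝ (Fin n)), f (natAct ι g x) = f x) :
    (∀ x, ∀ v ∈ clarkeSubdiff f x,
      (∀ α : ℝ, conservedMap d ι (x + α • v) =
        conservedMap d ι x + α ^ 2 • conservedMap d ι v) ∧
      DifferentiableAt ℝ (conservedMap d ι) x ∧
      fderiv ℝ (conservedMap d ι) x v = 0) ∧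
    (∀ (J : Set ℝ) (x : ℝ → EuclideanSpace ℝ (Fin n)), J.OrdConnected →
      IsSubgradientTrajectory f J x →
      (∀ᵐ t ∂volume.restrict J, HasDerivAt (fun s => conservedMap d ι (x s)) 0 t) ∧
      ∀ s ∈ J, ∀ t ∈ J, conservedMap d ι (x s) = conservedMap d ι (x t)) := by
  have hcross : ∀ x, ∀ v ∈ clarkeSubdiff f x, projOuterProd (symmPart (lieAlg d ι)) v x = 0 :=
    fun x v hv => projOuterProd_eq_zero_iff.2 fun A hA =>
      projOuterProd_eq_zero_iff.1 (projOuterProd_eq_zero_of_mem_clarkeSubdiff hι hf_inv hv) A hA.1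
  have hfderiv : ∀ x, ∀ v ∈ clarkeSubdiff f x, fderiv ℝ (conservedMap d ι) x v = 0 :=
    fun x v hv => by rw [fderiv_conservedMap_apply, hcross x v hv, smul_zero]
  have hsmooth : ContDiff ℝ 1 (conservedMap d ι) := contDiff_conservedMap ι
  have hdiff : Differentiable ℝ (conservedMap d ι) := hsmooth.differentiable one_ne_zero
  refine ⟨fun x v hv => ⟨fun α => ?_, hdiff x, hfderiv x v hv⟩, fun J x hJ hx =>
    ⟨hx.ae_hasDerivAt_comp_zero hdiff hfderiv,
      fun s hs t ht => hx.comp_eq hJ hsmooth hfderiv hs ht⟩⟩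
  rw [conservedMap_add_smul, hcross x v hv, smul_zero, add_zero]

theorem mainTheorem4 {n d : ℕ} {k : ℕ∞} (hk : 1 ≤ k)
    {G : Type*} [Group G] [TopologicalSpace G] [T2Space G] [SecondCountableTopology G]
    [ChartedSpace (EuclideanSpace ℝ (Fin d)) G]
    [LieGroup 𝓘(ℝ, EuclideanSpace ℝ (Fin d)) k G]
    (ι : G →* GL (Fin n) ℝ) (hι : IsLieSubgroup d k ι)
    (f : EuclideanSpace ℝ (Fin n) → EReal) (hf_bot : ∀ x, f x ≠ ⊥)
    (hf_inv : ∀ (g : G) (x : EuclideanSpace ℝ (Fin n)), f (natAct ι g x) = f x)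
    (xbar : EuclideanSpace ℝ (Fin n)) (hxbar : xbar ∈ effDom f)
    (h : (IsFreeAt ι xbar ∨ IsTypicalAt ι xbar) ∨
      ((xbar ∈ interior (effDom f) ∧ IsLipschitzNear f xbar) ∨ IsRegularFunAt f xbar)) :
    ∃ U : Set (EuclideanSpace ℝ (Fin n)), IsOpen U ∧ xbar ∈ U ∧
      (∀ x ∈ U, (limitingSubdiff f x).Nonempty → ∀ v ∈ clarkeSubdiff f x,
        (∀ α : ℝ, conservedMap d ι (x + α • v) =
          conservedMap d ι x + α ^ 2 • conservedMap d ι v) ∧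
        DifferentiableAt ℝ (conservedMap d ι) x ∧
        fderiv ℝ (conservedMap d ι) x v = 0) ∧
      (∀ (J : Set ℝ) (x : ℝ → EuclideanSpace ℝ (Fin n)), J.OrdConnected →
        IsSubgradientTrajectory f J x →
        (∀ᵐ t ∂volume.restrict J, x t ∈ U →
          HasDerivAt (fun s => conservedMap d ι (x s)) 0 t) ∧
        ∀ I : Set ℝ, I ⊆ J → I.OrdConnected → (∀ t ∈ I, x t ∈ U) →
          ∀ s ∈ I, ∀ t ∈ I, conservedMap d ι (x s) = conservedMap d ι (x t)) := by
  obtain ⟨hpoint, hflow⟩ := mainTheorem4_general ι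
    (hι.contMDiff.contMDiffAt.mdifferentiableAt (by exact_mod_cast (zero_lt_one.trans_le hk).ne'))
    f hf_inv
  exact ⟨univ, isOpen_univ, mem_univ _, fun x _ _ => hpoint x, fun J x hJ hx =>
    ⟨(hflow J x hJ hx).1.mono fun _ ht _ => ht,
      fun I hIJ _ _ s hs t ht => (hflow J x hJ hx).2 s (hIJ hs) t (hIJ ht)⟩⟩
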